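/- **Setting.** A (metric uncapacitated) facility location problem consists of a finite set $F$ of facilities, a finite set $C$ of clients, a metric $dist$ on $F\cup C$ (distinct points may be at distance $0$) and opening costs $\mathrm{open}(f)\ge 0$, $f\in F$. For $S\subseteq F$ let $\mathrm{open}(S)=\sum_{f\in S}\mathrm{open}(f)$ and $d(S)=\sum_{j\in C}\min_{f\in S}dist(j,f)$. Let $\mathrm{OPT}\subseteq F$ be any feasible solution, in which each client $j$ is served by a closest facility $\mathrm{OPT}(j)\in \mathrm{OPT}$ (ties broken arbitrarily); for $f\in\mathrm{OPT}$ let $d(f)=\sum_{j:\,\mathrm{OPT}(j)=f}dist(j,f)$, and for $\mathrm{OPT}'\subseteq\mathrm{OPT}$ let $d(\mathrm{OPT}')=\sum_{f\in\mathrm{OPT}'}d(f)$. **JMS algorithm.** Initially all clients are active, no facility is open, and $\alpha_j=0$ for all $j\in C$. At any time, client $j$ offers to each closed facility $f$ the amount $\max\{0,\alpha_j-dist(j,f)\}$ if $j$ is active, and $\max\{0,dist(j,S(j))-dist(j,f)\}$ if $j$ is connected to $S(j)$. The $\alpha_j$ of active clients grow at a uniform rate until an event happens: if $\alpha_j=dist(j,f)$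 for an active $j$ and an open $f$, then $j$ is connected to $f$ (and is no longer active); if the offers to a closed facility $f$ sum up to $\mathrm{open}(f)$, then $f$ is opened and all clients with a strictly positive offer to $f$ are (re)connected to $f$ (and are no longer active). Simultaneous events are processed in any order. The algorithm stops when no client is active and returns the set $S$ of open facilities. **Linear programs.** For an integer $q\ge1$ and $T\ge0$, let $LP_{JMS}(q,T)$ be the problem of maximizing $\sum_{i=1}^q\alpha_i-\lambda$ over nonnegative $\alpha_i,d_i$ ($1\le i\le q$), $r_{j,i}$ ($1\le j\le i\le q$) and $\lambda$ subject to: $\sum_{i=1}^q d_i=1$; $\alpha_i\le\alpha_{i+1}$ for $1\le i<q$; $r_{j,i+1}\le r_{j,i}$ for $1\le j\le i<q$; $\alpha_i\le r_{j,i}+d_i+d_j$ for $1\le j<i\le q$; $r_{j,j}\le\alpha_j$ for $1\le j\le q$; $\lambda\le T$; and, for $1\le i\le q$, $$\sum_{j=1}^{i-1}\max\{r_{j,i}-d_j,0\}+\sum_{j=i}^{q}\max\{\alpha_i-d_j,0\}\le\lambda .$$ $LP^+_{JMS}(q,T)$ is obtained by replacing the last family of constraints by $$\sum_{j=1}^{i}\max\{r_{j,i}-d_j,0\}+\sum_{j=i+1}^{q}\max\{\alpha_i-d_j,0\}\le\lambda\qquad(1\le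 i\le q).$$ Let $opt_{JMS}(q,T)$ and $opt^+_{JMS}(q,T)$ be the suprema of the objective values (possibly $+\infty$; e.g. $opt^+_{JMS}(1,T)=+\infty$), and $opt_{JMS}(T)=\sup_{q\ge1}opt_{JMS}(q,T)$. **Statement.** Let $\mathrm{OPT}$ be a feasible solution and let $S$ be the solution returned by (any run of) the JMS algorithm on the same problem. Then $$\mathrm{open}(S)+d(S)\le \mathrm{open}(\mathrm{OPT})+\sum_{f^*\in\mathrm{OPT}}opt_{JMS}\Big(\frac{\mathrm{open}(f^*)}{d(f^*)}\Big)\cdot d(f^*),$$ where the terms with $d(f^*)=0$ are read as $0$. Moreover, for every $T>0$, every $\mathrm{OPT}'\subseteq\mathrm{OPT}$ with $\mathrm{open}(\mathrm{OPT}')\le T\cdot d(\mathrm{OPT}')$, and every integer $q>0$, $$\mathrm{open}(S)+d(S)\le \mathrm{open}(\mathrm{OPT})+2\,d(\mathrm{OPT}\setminus\mathrm{OPT}')+opt^+_{JMS}(q,T)\cdot d(\mathrm{OPT}'),$$ with the convention $\infty\cdot 0=0$. -/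

import Mathlib

noncomputable section

/-- An uncapacitated facility location (UFL) problem with facilities `F` and clients `C`: a metric
on `F ∪ C` (distinct points are allowed to be at distance zero, so that clients and facilities may
share a location) and nonnegative opening costs. -/
structure UFLProblem (F C : Type*) where
  metric : PseudoMetricSpace (F ⊕ C)
  openCost : F → ℝ
  openCost_nonneg : ∀ f, 0 ≤ openCost f

namespace UFLProblem

variable {F C : Type*} (P : UFLProblem F C)

/-- The distance `dist(j, f)` between a client `j` and a facility `f`. -/
def dist (j : C) (f : F) : ℝ := P.metric.dist (Sum.inr j) (Sum.inl f)

/-- `open(S) = ∑ f ∈ S, open(f)`. -/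
def openSum (S : Finset F) : ℝ := ∑ f ∈ S, P.openCost f

/-- `dist(j, S) = min_{f ∈ S} dist(j, f)`, equal to `+∞` if `S` is empty. -/
def distTo (j : C) (S : Finset F) : EReal := ⨅ f ∈ S, ((P.dist j f : ℝ) : EReal)

/-- The connection cost `d(S) = ∑_j dist(j, S)`. -/
def connCost [Fintype C] (S : Finset F) : EReal := ∑ j : C, P.distTo j S

/-- `σ j` is the facility serving client `j` in the solution `S`: a closest facility of `S`
(ties are broken arbitrarily). -/
def IsServedBy (S : Finset F) (σ : C → F) : Prop :=
  ∀ j, σ j ∈ S ∧ ∀ f ∈ S, P.dist j (σ j) ≤ P.dist j f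

/-- `d(f)`: the connection cost of the clients that are served by `f` under the assignment `σ`. -/
def servedCost [Fintype C] [DecidableEq F] (σ : C → F) (f : F) : ℝ :=
  ∑ j ∈ Finset.univ.filter (fun j => σ j = f), P.dist j f

/-- `d(S') = ∑_{f ∈ S'} d(f)` for a set `S'` of facilities of the solution with assignment `σ`. -/
def servedCostSum [Fintype C] [DecidableEq F] (σ : C → F) (S' : Finset F) : ℝ :=
  ∑ f ∈ S', P.servedCost σ f

end UFLProblem

/-! ### The JMS algorithm -/

/-- A state of the JMS algorithm: the set of open facilities, the facility `S(j)` to which client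
`j` is connected (`none` if `j` is still active), and the dual variables `α`. -/
structure JMSState (F C : Type*) where
  opened : Finset F
  conn : C → Option F
  α : C → ℝ

namespace JMSState

variable {F C : Type*}

/-- Initially all clients are active, no facility is open, and `α = 0`. -/
def init : JMSState F C := ⟨∅, fun _ => none, fun _ => 0⟩

/-- Some client is active. -/
def HasActive (s : JMSState F C) : Prop := ∃ j, s.conn j = none

/-- The offer of client `j` to a closed facility `f`. -/
def offer (P : UFLProblem F C) (s : JMSState F C) (j : C) (f : F) : ℝ :=
  match s.conn j with
  | none => max 0 (s.α j - P.dist j f)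
  | some g => max 0 (P.dist j g - P.dist j f)

/-- Increase the dual variables of all active clients by `t`. -/
def raise (s : JMSState F C) (t : ℝ) : JMSState F C where
  opened := s.opened
  conn := s.conn
  α := fun j =>
    match s.conn j with
    | none => s.α j + t
    | some _ => s.α j

/-- The dual variable of the active client `j` equals its distance to the open facility `f`. -/
def CanConnect (P : UFLProblem F C) (s : JMSState F C) (j : C) (f : F) : Prop :=
  s.conn j = none ∧ f ∈ s.opened ∧ s.α j = P.dist j f

/-- The offers to the closed facility `f` reach its opening cost. -/
def CanOpen [Fintype C] (P : UFLProblem F C) (s : JMSState F C) (f : F) : Prop :=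
  f ∉ s.opened ∧ ∑ j : C, s.offer P j f = P.openCost f

/-- Some event happens in the state `s`. -/
def HasEvent [Fintype C] (P : UFLProblem F C) (s : JMSState F C) : Prop :=
  (∃ j f, s.CanConnect P j f) ∨ ∃ f, s.CanOpen P f

/-- Connect the client `j` to the open facility `f`. -/
def connect [DecidableEq C] (s : JMSState F C) (j : C) (f : F) : JMSState F C where
  opened := s.opened
  conn := Function.update s.conn j (some f)
  α := s.α

open Classical in
/-- Open the facility `f` and connect to it all clients whose offer to `f` is positive. -/
def openFacility [DecidableEq F] (P : UFLProblem F C) (s : JMSState F C) (f : F) :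
    JMSState F C where
  opened := insert f s.opened
  conn := fun j => if 0 < s.offer P j f then some f else s.conn j
  α := s.α

/-- One step of the JMS algorithm. As long as some client is active, either the dual variables of
the active clients grow uniformly until the first moment at which an event happens, or an event
that happens now is processed (simultaneous events are processed in an arbitrary order). -/
inductive Step [Fintype C] [DecidableEq F] [DecidableEq C] (P : UFLProblem F C) :
    JMSState F C → JMSState F C → Prop
  | raise (s : JMSState F C) (t : ℝ) (hactive : s.HasActive) (ht : 0 < t)
      (hbefore : ∀ u, 0 ≤ u → u < t → ¬ (s.raise u).HasEvent P)
      (hevent : (s.raise t).HasEvent P) : Step P s (s.raise t)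
  | connect (s : JMSState F C) (j : C) (f : F) (hactive : s.HasActive)
      (h : s.CanConnect P j f) : Step P s (s.connect j f)
  | openFacility (s : JMSState F C) (f : F) (hactive : s.HasActive)
      (h : s.CanOpen P f) : Step P s (s.openFacility P f)

end JMSState

/-- `S` is the set of open facilities returned by a run of the JMS algorithm, i.e. the set of open
facilities at the moment when no client is active any more. -/
def UFLProblem.IsJMSOutput {F C : Type*} [Fintype C] [DecidableEq F] [DecidableEq C]
    (P : UFLProblem F C) (S : Finset F) : Prop :=
  ∃ s : JMSState F C, Relation.ReflTransGen (JMSState.Step P) JMSState.init s ∧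
    ¬ s.HasActive ∧ s.opened = S

/-! ### The factor-revealing linear programs -/

/-- The variables of the factor-revealing LPs. Only the entries `α i`, `d i` with `1 ≤ i ≤ q` and
`r j i` with `1 ≤ j ≤ i ≤ q` matter. -/
structure JMSVars where
  α : ℕ → ℝ
  d : ℕ → ℝ
  r : ℕ → ℕ → ℝ
  lam : ℝ

/-- The constraints that are common to both LPs with parameters `q` and `T`. -/
structure JMSVars.Common (q : ℕ) (T : ℝ) (x : JMSVars) : Prop where
  α_nonneg : ∀ i, 1 ≤ i → i ≤ q → 0 ≤ x.α i
  d_nonneg : ∀ i, 1 ≤ i → i ≤ q → 0 ≤ x.d i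
  r_nonneg : ∀ j i, 1 ≤ j → j ≤ i → i ≤ q → 0 ≤ x.r j i
  lam_nonneg : 0 ≤ x.lam
  sum_d : ∑ i ∈ Finset.Icc 1 q, x.d i = 1
  α_mono : ∀ i, 1 ≤ i → i < q → x.α i ≤ x.α (i + 1)
  r_anti : ∀ j i, 1 ≤ j → j ≤ i → i < q → x.r j (i + 1) ≤ x.r j i
  triangle : ∀ j i, 1 ≤ j → j < i → i ≤ q → x.α i ≤ x.r j i + x.d i + x.d j
  r_diag : ∀ j, 1 ≤ j → j ≤ q → x.r j j ≤ x.α j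
  lam_le : x.lam ≤ T

/-- Feasibility for `LP_JMS(q, T)`. -/
def JMSVars.Feasible (q : ℕ) (T : ℝ) (x : JMSVars) : Prop :=
  x.Common q T ∧ ∀ i, 1 ≤ i → i ≤ q →
    ∑ j ∈ Finset.Ico 1 i, max (x.r j i - x.d j) 0
      + ∑ j ∈ Finset.Icc i q, max (x.α i - x.d j) 0 ≤ x.lam

/-- Feasibility for `LP⁺_JMS(q, T)`. -/
def JMSVars.FeasiblePlus (q : ℕ) (T : ℝ) (x : JMSVars) : Prop :=
  x.Common q T ∧ ∀ i, 1 ≤ i → i ≤ q →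
    ∑ j ∈ Finset.Icc 1 i, max (x.r j i - x.d j) 0
      + ∑ j ∈ Finset.Ioc i q, max (x.α i - x.d j) 0 ≤ x.lam

/-- The common objective function `∑ α_i - λ`. -/
def JMSVars.value (q : ℕ) (x : JMSVars) : ℝ := ∑ i ∈ Finset.Icc 1 q, x.α i - x.lam

/-- `opt_JMS(q, T)`, the optimal value of `LP_JMS(q, T)`. -/
def optJMSq (q : ℕ) (T : ℝ) : EReal :=
  ⨆ (x : JMSVars) (_ : x.Feasible q T), ((x.value q : ℝ) : EReal)

/-- `opt_JMS(T) = sup_q opt_JMS(q, T)`, over the positive integers `q`. -/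
def optJMS (T : ℝ) : EReal := ⨆ (q : ℕ) (_ : 0 < q), optJMSq q T

/-- `opt⁺_JMS(q, T)`, the optimal value of `LP⁺_JMS(q, T)`; it is `+∞` if the LP is unbounded,
which happens for `q = 1`. -/
def optJMSPlus (q : ℕ) (T : ℝ) : EReal :=
  ⨆ (x : JMSVars) (_ : x.FeasiblePlus q T), ((x.value q : ℝ) : EReal)

end

noncomputable section

/-! The argument is dual fitting. Call the radius of a client its α while it is active and the
distance to its facility afterwards. Opening f lowers the radii by exactly open(f) in total, so the
final α's pay for open(S) + d(S). It remains to bound the sum of α over the cluster of each facility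
f of OPT, minus open(f). All that is used about a run is recorded in `JMSDual`: at the moment a
client gets connected, the offers to any facility are at most its opening cost, and a later α is
bounded by an earlier radius through the triangle inequality.

Sort a cluster by connection time, with dual values a and distances d to f, and let p l maximize a -
d over the indices from l on. Put r(k, l) = max(a(p l) - d(p l) - d k, 0). This is the least
nonnegative value that the triangle constraints and monotonicity force, and for k < l the
untruncated value is at most the true radius. Hence the cluster itself is a point of LP_JMS with q =
|K|, up to scaling (`offers_grouped`).

For LP⁺ with a prescribed q, replace each client by q copies, cut the sorted copies into q blocks of
|K| and merge each block. Merging is compatible with the offer constraints because LP⁺ charges a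
block's own clients by r rather than by α (`sum_jmsPlus_le`, `offersPlus_grouped`). All clusters now
give points of the same dimension in a convex cone, so they can be added; normalizing the sum
requires only the aggregate bound open(OPT') ≤ T d(OPT'). The other clusters, and the case of zero
connection cost, are covered by `sum_le_two`. -/

theorem UFLProblem.dist_nonneg {F C : Type*} (P : UFLProblem F C) (j : C) (f : F) :
    0 ≤ P.dist j f :=
  let _ := P.metric
  _root_.dist_nonneg (x := (Sum.inr j : F ⊕ C)) (y := Sum.inl f)

theorem UFLProblem.dist_le_add {F C : Type*} (P : UFLProblem F C) (i j : C) (f g : F) :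
    P.dist i g ≤ P.dist i f + P.dist j f + P.dist j g := by
  let _ := P.metric
  have h := dist_triangle4 (Sum.inr i : F ⊕ C) (Sum.inl f) (Sum.inr j) (Sum.inl g)
  rw [dist_comm (Sum.inl f : F ⊕ C) (Sum.inr j)] at h
  exact h

theorem EReal.coe_finset_sum {ι : Type*} (s : Finset ι) (f : ι → ℝ) :
    ((∑ i ∈ s, f i : ℝ) : EReal) = ∑ i ∈ s, (f i : EReal) := by
  classical
  induction s using Finset.induction_on with
  | empty => simp
  | insert i s hi ih => rw [Finset.sum_insert hi, Finset.sum_insert hi, EReal.coe_add, ih]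

/-! ### Invariants of the JMS algorithm -/

namespace JMSState

variable {F C : Type*}

/-- The radius of client `j`: its dual variable while it is active, and the distance to its
facility once it is connected. -/
def radius (P : UFLProblem F C) (s : JMSState F C) (j : C) : ℝ :=
  match s.conn j with
  | none => s.α j
  | some g => P.dist j g

theorem radius_of_active (P : UFLProblem F C) {s : JMSState F C} {j : C} (h : s.conn j = none) :
    s.radius P j = s.α j := by simp [radius, h]

theorem radius_of_conn (P : UFLProblem F C) {s : JMSState F C} {j : C} {g : F}
    (h : s.conn j = some g) : s.radius P j = P.dist j g := by simp [radius, h]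

theorem offer_eq (P : UFLProblem F C) (s : JMSState F C) (j : C) (f : F) :
    s.offer P j f = max 0 (s.radius P j - P.dist j f) := by
  unfold offer radius
  cases s.conn j <;> rfl

theorem conn_raise (s : JMSState F C) (t : ℝ) (j : C) : (s.raise t).conn j = s.conn j := rfl

theorem α_raise_of_active {s : JMSState F C} (t : ℝ) {j : C} (h : s.conn j = none) :
    (s.raise t).α j = s.α j + t := by simp [raise, h]

theorem α_raise_of_conn {s : JMSState F C} (t : ℝ) {j : C} {g : F} (h : s.conn j = some g) :
    (s.raise t).α j = s.α j := by simp [raise, h]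

theorem radius_connect [DecidableEq C] {P : UFLProblem F C} {s : JMSState F C} {i : C} {f : F} (h : s.CanConnect P i f) (j : C) :
    (s.connect i f).radius P j = s.radius P j := by
  obtain ⟨h1, -, h3⟩ := h
  by_cases hj : j = i
  · subst hj
    simp [radius, connect, h1, h3]
  · simp [radius, connect, hj]

theorem radius_openFacility [DecidableEq F] (P : UFLProblem F C) (s : JMSState F C) (f : F) (j : C) :
    (s.openFacility P f).radius P j = min (s.radius P j) (P.dist j f) := by
  by_cases h : 0 < s.offer P j f
  · have h1 : (s.openFacility P f).conn j = some f := by simp [openFacility, h]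
    rw [radius_of_conn P h1]
    rw [offer_eq, lt_max_iff] at h
    rw [min_eq_right]
    rcases h with h | h <;> linarith
  · have h1 : (s.openFacility P f).conn j = s.conn j := by simp [openFacility, h]
    have h2 : (s.openFacility P f).radius P j = s.radius P j := by
      unfold radius
      rw [h1]
      rfl
    rw [h2]
    rw [offer_eq, lt_max_iff] at h
    push Not at h
    rw [min_eq_left]
    linarith [h.2]

theorem conn_openFacility_active [DecidableEq F] {P : UFLProblem F C} {s : JMSState F C} {f : F} {j : C}
    (h : (s.openFacility P f).conn j = none) : s.conn j = none := by
  by_cases hj : 0 < s.offer P j f <;> simp_all [openFacility]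

/-- The invariants of the JMS algorithm. -/
structure Valid [Fintype C] (P : UFLProblem F C) (s : JMSState F C) : Prop where
  α_nonneg : ∀ j, 0 ≤ s.α j
  α_le : ∀ i j, s.conn i = none → s.α j ≤ s.α i
  α_le_dist : ∀ i f, s.conn i = none → f ∈ s.opened → s.α i ≤ P.dist i f
  conn_mem : ∀ j g, s.conn j = some g → g ∈ s.opened
  conn_closest : ∀ j g f, s.conn j = some g → f ∈ s.opened → P.dist j g ≤ P.dist j f
  offers_le : ∀ f, f ∉ s.opened → ∑ j, s.offer P j f ≤ P.openCost f
  cost_le : P.openSum s.opened + ∑ j, s.radius P j ≤ ∑ j, s.α j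

variable [Fintype C] {P : UFLProblem F C}

theorem valid_init : (init : JMSState F C).Valid P where
  α_nonneg _ := le_rfl
  α_le _ _ _ := le_rfl
  α_le_dist _ f _ h := by simp [init] at h
  conn_mem _ _ h := by simp [init] at h
  conn_closest _ _ _ h := by simp [init] at h
  offers_le f _ := by
    have : ∀ j, (init : JMSState F C).offer P j f = 0 := fun j => by
      rw [offer_eq, radius_of_active P rfl]
      exact max_eq_left (by simpa [init] using P.dist_nonneg j f)
    simpa [this] using P.openCost_nonneg f
  cost_le := by simp [init, radius, UFLProblem.openSum]

theorem Valid.radius_le_dist {s : JMSState F C} (hs : s.Valid P) (j : C) {f : F}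
    (hf : f ∈ s.opened) : s.radius P j ≤ P.dist j f := by
  cases h : s.conn j with
  | none => rw [radius_of_active P h]; exact hs.α_le_dist j f h hf
  | some g => rw [radius_of_conn P h]; exact hs.conn_closest j g f h hf

theorem Valid.sum_offer_le {s : JMSState F C} (hs : s.Valid P) (f : F) :
    ∑ j, max (s.radius P j - P.dist j f) 0 ≤ P.openCost f := by
  by_cases hf : f ∈ s.opened
  · have : ∀ j, max (s.radius P j - P.dist j f) 0 = 0 := fun j =>
      max_eq_right (sub_nonpos.2 (hs.radius_le_dist j hf))
    simpa [this] using P.openCost_nonneg f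
  · have := hs.offers_le f hf
    simpa only [offer_eq, max_comm] using this

/-- If j is connected to g, then α i has not passed the distance from i to the open facility g,
which is at most the path i, f, j, g. If j is active, α i ≤ α j already suffices. -/
theorem Valid.α_le_radius_add {s : JMSState F C} (hs : s.Valid P) {i : C} (hi : s.conn i = none)
    (j : C) (f : F) : s.α i ≤ s.radius P j + P.dist j f + P.dist i f := by
  have h1 := P.dist_nonneg j f
  have h2 := P.dist_nonneg i f
  cases h : s.conn j with
  | none =>
    rw [radius_of_active P h]
    have := hs.α_le j i h
    linarith
  | some g =>
    rw [radius_of_conn P h]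
    have := hs.α_le_dist i g hi (hs.conn_mem j g h)
    have := P.dist_le_add i j f g
    linarith

theorem continuous_sum_offer_raise (s : JMSState F C) (f : F) :
    Continuous fun t => ∑ j, (s.raise t).offer P j f := by
  refine continuous_finsetSum _ fun j _ => ?_
  cases h : s.conn j with
  | none => simp only [offer, conn_raise, h, α_raise_of_active _ h]; fun_prop
  | some g => simp only [offer, conn_raise, h]; fun_prop

theorem Valid.raise {s : JMSState F C} (hs : s.Valid P) {t : ℝ} (ht : 0 < t)
    (hbefore : ∀ u, 0 ≤ u → u < t → ¬ (s.raise u).HasEvent P) : (s.raise t).Valid P where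
  α_nonneg j := by
    have := hs.α_nonneg j
    cases h : s.conn j with
    | none => rw [α_raise_of_active _ h]; linarith
    | some g => rwa [α_raise_of_conn _ h]
  α_le i j hi := by
    have hi' : s.conn i = none := hi
    have h1 := hs.α_le i j hi'
    rw [α_raise_of_active (j := i) _ hi']
    cases h : s.conn j with
    | none => rw [α_raise_of_active _ h]; linarith
    | some g => rw [α_raise_of_conn _ h]; linarith
  α_le_dist i f hi hf := by
    have hi' : s.conn i = none := hi
    have h1 := hs.α_le_dist i f hi hf
    rw [α_raise_of_active (j := i) _ hi']
    by_contra! hlt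
    -- The moment at which α i meets the distance would be a connection event before t.
    refine hbefore (P.dist i f - s.α i) (by linarith) (by linarith) (Or.inl ⟨i, f, hi, hf, ?_⟩)
    rw [α_raise_of_active _ hi']
    ring
  conn_mem := hs.conn_mem
  conn_closest := hs.conn_closest
  offers_le f hf := by
    by_contra! hlt
    have h0 : ∑ j, (s.raise 0).offer P j f ≤ P.openCost f := by
      have : s.raise 0 = s := by
        have : (s.raise 0).α = s.α := by
          funext j
          cases h : s.conn j with
          | none => rw [α_raise_of_active _ h, add_zero]
          | some g => rw [α_raise_of_conn _ h]
        cases s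
        simpa [JMSState.raise] using this
      rw [this]
      exact hs.offers_le f hf
    -- The offers vary continuously, so they hit the opening cost before exceeding it, which is an
    -- opening event before t.
    obtain ⟨u, hu, hu'⟩ := intermediate_value_Icc ht.le
      (continuous_sum_offer_raise (P := P) s f).continuousOn ⟨h0, hlt.le⟩
    have hut : u ≠ t := by
      rintro rfl
      exact hlt.ne' hu'
    exact hbefore u hu.1 (lt_of_le_of_ne hu.2 hut) (Or.inr ⟨f, hf, hu'⟩)
  cost_le := by
    have h : ∑ j, ((s.raise t).radius P j - (s.raise t).α j) = ∑ j, (s.radius P j - s.α j) := by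
      refine Finset.sum_congr rfl fun j _ => ?_
      cases h : s.conn j with
      | none => simp [radius, conn_raise, h]
      | some g => simp [radius, conn_raise, h, α_raise_of_conn _ h]
    simp only [Finset.sum_sub_distrib] at h
    have := hs.cost_le
    change P.openSum s.opened + _ ≤ _
    linarith

theorem Valid.connect [DecidableEq C] {s : JMSState F C} (hs : s.Valid P) {i : C} {f : F}
    (h : s.CanConnect P i f) : (s.connect i f).Valid P := by
  have hact : ∀ j, (s.connect i f).conn j = none → s.conn j = none := fun j hj => by
    by_cases hji : j = i
    · exact hji ▸ h.1
    · simpa [JMSState.connect, hji] using hj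
  have hsome : ∀ j g, (s.connect i f).conn j = some g → s.conn j = some g ∨ (j = i ∧ g = f) := by
    intro j g hj
    by_cases hji : j = i
    · subst hji
      right
      simpa [JMSState.connect, eq_comm] using hj
    · left
      simpa [JMSState.connect, hji] using hj
  refine ⟨hs.α_nonneg, fun k j hk => hs.α_le k j (hact k hk),
    fun k g hk hg => hs.α_le_dist k g (hact k hk) hg, fun j g hj => ?_, fun j g f' hj hf' => ?_,
    fun g hg => ?_, ?_⟩
  · rcases hsome j g hj with h1 | ⟨rfl, rfl⟩
    · exact hs.conn_mem j g h1
    · exact h.2.1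
  · have := hs.radius_le_dist j (f := f') hf'
    rwa [← radius_connect h, radius_of_conn P hj] at this
  · simpa only [offer_eq, radius_connect h] using hs.offers_le g hg
  · have := hs.cost_le
    simp only [radius_connect h]
    exact this

variable [DecidableEq F]

theorem Valid.openFacility {s : JMSState F C} (hs : s.Valid P) {f : F} (h : s.CanOpen P f) :
    (s.openFacility P f).Valid P := by
  have hrad : ∀ j g, g ∈ (s.openFacility P f).opened →
      (s.openFacility P f).radius P j ≤ P.dist j g := by
    intro j g hg
    rw [radius_openFacility]
    rcases Finset.mem_insert.1 hg with rfl | hg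
    · exact min_le_right _ _
    · exact (min_le_left _ _).trans (hs.radius_le_dist j hg)
  refine ⟨hs.α_nonneg, fun i j hi => hs.α_le i j (conn_openFacility_active hi),
    fun i g hi hg => ?_, fun j g hj => ?_, fun j g f' hj hf' => ?_, fun g hg => ?_, ?_⟩
  · have := hrad i g hg
    rwa [radius_of_active P hi] at this
  · by_cases hp : 0 < s.offer P j f
    · have : f = g := by simpa [JMSState.openFacility, hp] using hj
      simp [JMSState.openFacility, this]
    · have : s.conn j = some g := by simpa [JMSState.openFacility, hp] using hj
      exact Finset.mem_insert_of_mem (hs.conn_mem j g this)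
  · have := hrad j f' hf'
    rwa [radius_of_conn P hj] at this
  · have hg' : g ∉ s.opened := fun h' => hg (Finset.mem_insert_of_mem h')
    refine (Finset.sum_le_sum fun j _ => ?_).trans (hs.offers_le g hg')
    rw [offer_eq, offer_eq, radius_openFacility]
    gcongr
    exact min_le_left _ _
  · have h1 : P.openSum (s.openFacility P f).opened = P.openCost f + P.openSum s.opened :=
      Finset.sum_insert h.1
    -- Each client's radius drops by precisely its offer, so the drop pays for f.
    have h2 : ∑ j, (s.openFacility P f).radius P j + ∑ j, s.offer P j f = ∑ j, s.radius P j := by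
      rw [← Finset.sum_add_distrib]
      refine Finset.sum_congr rfl fun j _ => ?_
      rw [radius_openFacility, offer_eq]
      rcases le_total (s.radius P j) (P.dist j f) with h' | h'
      · rw [min_eq_left h', max_eq_left (by linarith)]; ring
      · rw [min_eq_right h', max_eq_right (by linarith)]; ring
    have h3 := hs.cost_le
    have h4 := h.2
    change _ ≤ ∑ j, s.α j
    linarith

variable [DecidableEq C]

theorem Step.valid {s s' : JMSState F C} (h : Step P s s') (hs : s.Valid P) : s'.Valid P := by
  cases h with
  | raise t _ ht hbefore _ => exact hs.raise ht hbefore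
  | connect j f _ h => exact hs.connect h
  | openFacility f _ h => exact hs.openFacility h

theorem Step.active {s s' : JMSState F C} (h : Step P s s') {j : C} (hj : s'.conn j = none) :
    s.conn j = none := by
  cases h with
  | raise t _ ht hbefore _ => exact hj
  | connect i f _ h =>
    by_cases hji : j = i
    · exact hji ▸ h.1
    · simpa [JMSState.connect, hji] using hj
  | openFacility f _ h => exact conn_openFacility_active hj

theorem Step.α_le {s s' : JMSState F C} (h : Step P s s') (j : C) : s.α j ≤ s'.α j := by
  cases h with
  | raise t _ ht hbefore _ =>
    cases h : s.conn j with
    | none => rw [α_raise_of_active _ h]; linarith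
    | some g => rw [α_raise_of_conn _ h]
  | connect i f _ h => exact le_rfl
  | openFacility f _ h => exact le_rfl

theorem Step.α_eq {s s' : JMSState F C} (h : Step P s s') {j : C} (hj : s'.conn j ≠ none) :
    s'.α j = s.α j := by
  cases h with
  | raise t _ ht hbefore _ =>
    obtain ⟨g, hg⟩ := Option.ne_none_iff_exists'.1 hj
    exact α_raise_of_conn t hg
  | connect i f _ h => rfl
  | openFacility f _ h => rfl

/-- A radius can grow only as the α of a client that stays active, hence the condition on the state
after the step. -/
theorem Step.radius_le {s s' : JMSState F C} (h : Step P s s') {j : C} (hj : s'.conn j ≠ none) :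
    s'.radius P j ≤ s.radius P j := by
  cases h with
  | raise t _ ht hbefore _ =>
    obtain ⟨g, hg⟩ := Option.ne_none_iff_exists'.1 hj
    rw [radius_of_conn P hg, radius_of_conn P (s := s) hg]
  | connect i f _ h => exact (radius_connect h j).le
  | openFacility f _ h => rw [radius_openFacility]; exact min_le_left _ _

end JMSState

/-! ### From a run to a dual solution -/

theorem Relation.ReflTransGen.exists_seq {α : Type*} {r : α → α → Prop} {a b : α}
    (h : Relation.ReflTransGen r a b) :
    ∃ (N : ℕ) (s : ℕ → α), s 0 = a ∧ s N = b ∧ ∀ n < N, r (s n) (s (n + 1)) := by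
  induction h with
  | refl => exact ⟨0, fun _ => a, rfl, rfl, by simp⟩
  | @tail b c _ hbc ih =>
    obtain ⟨N, s, h0, hN, hs⟩ := ih
    refine ⟨N + 1, Function.update s (N + 1) c, by simpa using h0, by simp, fun n hn => ?_⟩
    rcases Nat.lt_succ_iff_lt_or_eq.1 hn with hn | rfl
    · rw [Function.update_of_ne (by omega), Function.update_of_ne (by omega)]
      exact hs n hn
    · rw [Function.update_of_ne (by omega), Function.update_self, hN]
      exact hbc

/-- The dual solution `α` computed by a run of the JMS algorithm that returns `S`. Here `τ` lists
the clients in the order in which they get connected, and `ρ i j` is the radius of client `j` at the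
last moment at which client `i` is active. -/
structure UFLProblem.JMSDual {F C : Type*} [Fintype C] (P : UFLProblem F C) (S : Finset F)
    (τ : C → ℕ) (α : C → ℝ) (ρ : C → C → ℝ) : Prop where
  α_nonneg : ∀ j, 0 ≤ α j
  α_mono : ∀ i j, τ i ≤ τ j → α i ≤ α j
  radius_eq : ∀ i j, τ i ≤ τ j → ρ i j = α i
  triangle : ∀ i i' j f, τ j ≤ τ i → τ i ≤ τ i' → α i' ≤ ρ i j + P.dist j f + P.dist i' f
  offers_le : ∀ i f, ∑ j, max (ρ i j - P.dist j f) 0 ≤ P.openCost f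
  cost_le : (P.openSum S : EReal) + P.connCost S ≤ ((∑ j, α j : ℝ) : EReal)

theorem UFLProblem.IsJMSOutput.exists_dual {F C : Type*} [Fintype C] [DecidableEq F]
    [DecidableEq C] {P : UFLProblem F C} {S : Finset F} (hS : P.IsJMSOutput S) :
    ∃ τ α ρ, P.JMSDual S τ α ρ := by
  obtain ⟨s', hrun, hfin, rfl⟩ := hS
  obtain ⟨N, s, h0, rfl, hstep⟩ := hrun.exists_seq
  have hvalid : ∀ n ≤ N, (s n).Valid P := by
    intro n
    induction n with
    | zero => intro _; rw [h0]; exact JMSState.valid_init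
    | succ n ih => intro hn; exact (hstep n hn).valid (ih (by omega))
  have hN : ∀ j, (s N).conn j ≠ none := fun j hj => hfin ⟨j, hj⟩
  have hact : ∀ j m n, m ≤ n → n ≤ N → (s n).conn j = none → (s m).conn j = none := by
    intro j m n hmn
    induction n, hmn using Nat.le_induction with
    | base => exact fun _ h => h
    | succ n _ ih => exact fun hn h => ih (by omega) ((hstep n hn).active h)
  have hex : ∀ j, ∃ n, n < N ∧ (s n).conn j = none ∧ (s (n + 1)).conn j ≠ none := by
    intro j
    by_contra! h
    have : ∀ n ≤ N, (s n).conn j = none := by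
      intro n
      induction n with
      | zero => intro _; rw [h0]; rfl
      | succ n ih => intro hn; exact h n hn (ih (by omega))
    exact hN j (this N le_rfl)
  -- τ j is the index of the last state in which j is active; clients connected by the same event
  -- share it.
  choose τ hτN hτ hτ' using hex
  have hle : ∀ j n, n ≤ τ j → (s n).conn j = none := fun j n hn =>
    hact j n _ hn (hτN j).le (hτ j)
  have hgt : ∀ j n, τ j < n → n ≤ N → (s n).conn j ≠ none := fun j n hn hnN h =>
    hτ' j (hact j _ n hn hnN h)
  have hαeq : ∀ j n, τ j ≤ n → n ≤ N → (s n).α j = (s (τ j)).α j := by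
    intro j n hn
    induction n, hn using Nat.le_induction with
    | base => exact fun _ => rfl
    | succ n hn ih =>
      intro hnN
      rw [(hstep n hnN).α_eq (hgt j _ (by omega) hnN), ih (by omega)]
  have hαmono : ∀ j m n, m ≤ n → n ≤ N → (s m).α j ≤ (s n).α j := by
    intro j m n hmn
    induction n, hmn using Nat.le_induction with
    | base => exact fun _ => le_rfl
    | succ n _ ih => exact fun hn => (ih (by omega)).trans ((hstep n hn).α_le j)
  have hρ : ∀ j m n, τ j ≤ m → m ≤ n → n ≤ N → (s n).radius P j ≤ (s m).radius P j := by
    intro j m n hm hmn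
    induction n, hmn using Nat.le_induction with
    | base => exact fun _ => le_rfl
    | succ n hn ih =>
      exact fun hnN => ((hstep n hnN).radius_le (hgt j _ (by omega) hnN)).trans (ih (by omega))
  have hsame : ∀ i j, τ i ≤ τ j → (s (τ i)).α j = (s (τ i)).α i := fun i j hij =>
    le_antisymm ((hvalid _ (hτN i).le).α_le i j (hτ i))
      ((hvalid _ (hτN i).le).α_le j i (hle j _ hij))
  refine ⟨τ, fun j => (s (τ j)).α j, fun i j => (s (τ i)).radius P j, ?_, ?_, ?_, ?_, ?_, ?_⟩
  · exact fun j => (hvalid _ (hτN j).le).α_nonneg j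
  · intro i j hij
    rw [← hsame i j hij]
    exact hαmono j _ _ hij (hτN j).le
  · intro i j hij
    rw [JMSState.radius_of_active P (hle j _ hij), hsame i j hij]
  · intro i i' j f hji hii'
    refine ((hvalid _ (hτN i').le).α_le_radius_add (hτ i') j f).trans ?_
    -- From index τ j on the radius of j never increases, so its value at τ i' may be replaced by
    -- the earlier one at τ i.
    have := hρ j _ _ hji hii' (hτN i').le
    linarith
  · exact fun i f => (hvalid _ (hτN i).le).sum_offer_le f
  · have hcost := (hvalid N le_rfl).cost_le
    have hα : ∑ j, (s N).α j = ∑ j, (s (τ j)).α j :=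
      Finset.sum_congr rfl fun j _ => hαeq j N (hτN j).le le_rfl
    have hconn : P.connCost (s N).opened ≤ ((∑ j, (s N).radius P j : ℝ) : EReal) := by
      rw [EReal.coe_finset_sum]
      refine Finset.sum_le_sum fun j _ => ?_
      obtain ⟨g, hg⟩ := Option.ne_none_iff_exists'.1 (hN j)
      rw [JMSState.radius_of_conn P hg]
      exact iInf₂_le g ((hvalid N le_rfl).conn_mem j g hg)
    rw [← hα]
    refine (add_le_add le_rfl hconn).trans ?_
    exact_mod_cast hcost

/-- The JMS algorithm is a Lagrangian multiplier preserving 2-approximation, cluster by cluster. -/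
theorem UFLProblem.JMSDual.sum_le_two {F C : Type*} [Fintype C] {P : UFLProblem F C}
    {S : Finset F} {τ : C → ℕ} {α : C → ℝ} {ρ : C → C → ℝ} (h : P.JMSDual S τ α ρ)
    (K : Finset C) (f : F) :
    ∑ j ∈ K, α j ≤ P.openCost f + 2 * ∑ j ∈ K, P.dist j f := by
  rcases K.eq_empty_or_nonempty with rfl | hK
  · simpa using P.openCost_nonneg f
  -- If i connects no later than j, then ρ i j = α i, while the triangle inequality at the moment of
  -- j bounds ρ j i from below.
  have hpair : ∀ i j, α i + α j - P.dist i f - P.dist j f ≤ ρ i j + ρ j i := by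
    intro i j
    rcases le_total (τ i) (τ j) with hij | hij
    · have := h.triangle j j i f hij le_rfl
      have := h.radius_eq i j hij
      linarith
    · have := h.triangle i i j f hij le_rfl
      have := h.radius_eq j i hij
      linarith
  have hle : ∀ i, ∑ j ∈ K, (ρ i j - P.dist j f) ≤ P.openCost f := fun i =>
    ((Finset.sum_le_sum fun j _ => le_max_left _ 0).trans
      (Finset.sum_le_univ_sum_of_nonneg fun j => le_max_right _ _)).trans (h.offers_le i f)
  have h1 := Finset.sum_le_sum fun i (_ : i ∈ K) => hle i
  have h2 := Finset.sum_le_sum fun i (_ : i ∈ K) => Finset.sum_le_sum fun j (_ : j ∈ K) => hpair i j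
  simp only [Finset.sum_sub_distrib, Finset.sum_add_distrib, Finset.sum_const, nsmul_eq_mul,
    ← Finset.mul_sum] at h1 h2
  -- Over all ordered pairs both ρ-terms have the same sum, which the |K| offer bounds in `h1`
  -- control.
  rw [Finset.sum_comm (f := fun i j => ρ j i)] at h2
  have hpos : (0 : ℝ) < K.card := by exact_mod_cast hK.card_pos
  refine le_of_mul_le_mul_left ?_ hpos
  linarith

/-! ### Sorted client sequences and offer bounds -/

theorem Finset.sum_Icc_pred (q : ℕ) (G : ℕ → ℝ) :
    ∑ i ∈ Finset.Icc 1 q, G (i - 1) = ∑ i ∈ Finset.range q, G i := by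
  refine Finset.sum_nbij' (fun i => i - 1) (fun i => i + 1) ?_ ?_ ?_ ?_ ?_ <;>
    simp only [Finset.mem_Icc, Finset.mem_range] <;> intros <;> first | omega | trivial

theorem Finset.sum_range_mul_blocks (q c : ℕ) (G : ℕ → ℝ) :
    ∑ k ∈ Finset.range (q * c), G k =
      ∑ g ∈ Finset.range q, ∑ b ∈ Finset.range c, G (g * c + b) := by
  induction q with
  | zero => simp
  | succ q ih => rw [Nat.succ_mul, Finset.sum_range_add, ih, Finset.sum_range_succ]

theorem Finset.sum_range_div (n q : ℕ) (hq : 0 < q) (G : ℕ → ℝ) :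
    ∑ k ∈ Finset.range (n * q), G (k / q) = q * ∑ k ∈ Finset.range n, G k := by
  rw [Finset.sum_range_mul_blocks, Finset.mul_sum]
  refine Finset.sum_congr rfl fun g _ => ?_
  rw [Finset.sum_congr rfl (g := fun _ => G g), Finset.sum_const, Finset.card_range, nsmul_eq_mul]
  intro b hb
  rw [Nat.mul_comm, Nat.mul_add_div hq, Nat.div_eq_of_lt (Finset.mem_range.1 hb), Nat.add_zero]

/-- A sequence of `N` clients in the order in which they get connected: dual variables `a`,
distances `d` to a fixed facility, and the radius `ρ l k` of client `k` when client `l` gets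
connected; `Λ` bounds the total offer to the facility. -/
structure ClientSequence (N : ℕ) (a d : ℕ → ℝ) (ρ : ℕ → ℕ → ℝ) (Λ : ℝ) : Prop where
  a_nonneg : ∀ k, 0 ≤ a k
  d_nonneg : ∀ k, 0 ≤ d k
  a_mono : Monotone a
  radius_eq : ∀ l k, l ≤ k → ρ l k = a l
  triangle : ∀ k l l', k ≤ l → l ≤ l' → a l' ≤ ρ l k + d k + d l'
  offers_le : ∀ l, ∑ k ∈ Finset.range N, max (ρ l k - d k) 0 ≤ Λ

/-- `p l` is an index at which `a - d` attains its maximum over `[l, N)`. -/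
def IsTailArgmax (N : ℕ) (v : ℕ → ℝ) (p : ℕ → ℕ) : Prop :=
  ∀ l < N, l ≤ p l ∧ p l < N ∧ ∀ l', l ≤ l' → l' < N → v l' ≤ v (p l)

theorem exists_isTailArgmax (N : ℕ) (v : ℕ → ℝ) : ∃ p, IsTailArgmax N v p := by
  have : ∀ l, ∃ p, l < N → l ≤ p ∧ p < N ∧ ∀ l', l ≤ l' → l' < N → v l' ≤ v p := by
    intro l
    by_cases hl : l < N
    · obtain ⟨p, hp, hmax⟩ := Finset.exists_max_image (Finset.Ico l N) v
        ⟨l, Finset.mem_Ico.2 ⟨le_rfl, hl⟩⟩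
      rw [Finset.mem_Ico] at hp
      exact ⟨p, fun _ => ⟨hp.1, hp.2, fun l' h1 h2 => hmax l' (Finset.mem_Ico.2 ⟨h1, h2⟩)⟩⟩
    · exact ⟨0, fun h => absurd h hl⟩
  choose p hp using this
  exact ⟨p, hp⟩

theorem IsTailArgmax.antitone {N : ℕ} {v : ℕ → ℝ} {p : ℕ → ℕ} (hp : IsTailArgmax N v p)
    {l l' : ℕ} (h : l ≤ l') (hl' : l' < N) : v (p l') ≤ v (p l) :=
  (hp l (by omega)).2.2 _ (h.trans (hp l' hl').1) (hp l' hl').2.1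

/-- Truncating r at 0, as the LPs require, does not increase any offer because distances are
nonnegative. -/
theorem max_sub_max_le {x y e : ℝ} (he : 0 ≤ e) (h : x ≤ y) :
    max (max x 0 - e) 0 ≤ max (y - e) 0 := by
  rcases le_total x 0 with hx | hx
  · rw [max_eq_right hx, max_eq_right (by linarith)]
    exact le_max_right _ _
  · rw [max_eq_left hx]
    gcongr

namespace ClientSequence

variable {N : ℕ} {a d : ℕ → ℝ} {ρ : ℕ → ℕ → ℝ} {Λ : ℝ}

theorem comp (h : ClientSequence N a d ρ Λ) {q : ℕ} (hq : 0 < q) :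
    ClientSequence (N * q) (fun k => a (k / q)) (fun k => d (k / q))
      (fun l k => ρ (l / q) (k / q)) (q * Λ) where
  a_nonneg _ := h.a_nonneg _
  d_nonneg _ := h.d_nonneg _
  a_mono _ _ hkl := h.a_mono (Nat.div_le_div_right hkl)
  radius_eq _ _ hkl := h.radius_eq _ _ (Nat.div_le_div_right hkl)
  triangle _ _ _ h1 h2 := h.triangle _ _ _ (Nat.div_le_div_right h1) (Nat.div_le_div_right h2)
  offers_le l := by
    rw [Finset.sum_range_div N q hq (fun k => max (ρ (l / q) k - d k) 0)]
    gcongr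
    exact h.offers_le _

/-- For k ≤ l this is the triangle inequality when k connects, its radius then being a k; otherwise
monotonicity of a is enough. It yields r(j, j) ≤ α(j). -/
theorem tail_sub_le (h : ClientSequence N a d ρ Λ) (k l : ℕ) : a l - d l - d k ≤ a k := by
  have h1 := h.d_nonneg l
  have h2 := h.d_nonneg k
  rcases le_total k l with hkl | hkl
  · have := h.triangle k k l le_rfl hkl
    rw [h.radius_eq k k le_rfl] at this
    linarith
  · have := h.a_mono hkl
    linarith

theorem sum_jms_le (h : ClientSequence N a d ρ Λ) {p : ℕ → ℕ}
    (hp : IsTailArgmax N (fun k => a k - d k) p) {l : ℕ} (hl : l < N) :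
    ∑ k ∈ Finset.range N,
      max ((if k < l then max (a (p l) - d (p l) - d k) 0 else a l) - d k) 0 ≤ Λ := by
  refine (Finset.sum_le_sum fun k _ => ?_).trans (h.offers_le l)
  split_ifs with hk
  · refine max_sub_max_le (h.d_nonneg k) ?_
    have := h.triangle k l (p l) hk.le (hp l hl).1
    linarith
  · rw [h.radius_eq l k (by omega)]

/-- Clients in [l, L) are charged by r too, so the offers are read at some t in [l, L) instead of at
l. If p l < L, take t = p l: earlier clients obey the triangle inequality, later ones have radius a
(p l). Otherwise take t = L - 1, when the triangle inequality covers every k < L. Clients from L on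
have radius a t ≥ a l. -/
theorem sum_jmsPlus_le (h : ClientSequence N a d ρ Λ) {p : ℕ → ℕ}
    (hp : IsTailArgmax N (fun k => a k - d k) p) {l L : ℕ} (hlL : l < L) (hL : L ≤ N) :
    ∑ k ∈ Finset.range N,
      max ((if k < L then max (a (p l) - d (p l) - d k) 0 else a l) - d k) 0 ≤ Λ := by
  obtain ⟨t, htL, hlt, ht⟩ : ∃ t < L, l ≤ t ∧ ∀ k < L, a (p l) - d (p l) - d k ≤ ρ t k := by
    have hlp := (hp l (by omega)).1
    rcases lt_or_ge (p l) L with hpL | hpL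
    · refine ⟨p l, hpL, hlp, fun k _ => ?_⟩
      rcases le_total k (p l) with hk | hk
      · have := h.triangle k (p l) (p l) hk le_rfl
        linarith
      · rw [h.radius_eq _ _ hk]
        have := h.d_nonneg (p l)
        have := h.d_nonneg k
        linarith
    · refine ⟨L - 1, by omega, by omega, fun k hk => ?_⟩
      have := h.triangle k (L - 1) (p l) (by omega) (by omega)
      linarith
  refine (Finset.sum_le_sum fun k _ => ?_).trans (h.offers_le t)
  split_ifs with hk
  · exact max_sub_max_le (h.d_nonneg k) (ht k hk)
  · rw [h.radius_eq t k (by omega)]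
    gcongr
    exact h.a_mono hlt

end ClientSequence

/-! ### Unnormalized solutions of the linear programs -/

namespace JMSVars

/-- The homogeneous constraints that are common to both LPs. -/
structure Cone (q : ℕ) (x : JMSVars) : Prop where
  α_nonneg : ∀ i, 1 ≤ i → i ≤ q → 0 ≤ x.α i
  d_nonneg : ∀ i, 1 ≤ i → i ≤ q → 0 ≤ x.d i
  r_nonneg : ∀ j i, 1 ≤ j → j ≤ i → i ≤ q → 0 ≤ x.r j i
  lam_nonneg : 0 ≤ x.lam
  α_mono : ∀ i, 1 ≤ i → i < q → x.α i ≤ x.α (i + 1)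
  r_anti : ∀ j i, 1 ≤ j → j ≤ i → i < q → x.r j (i + 1) ≤ x.r j i
  triangle : ∀ j i, 1 ≤ j → j < i → i ≤ q → x.α i ≤ x.r j i + x.d i + x.d j
  r_diag : ∀ j, 1 ≤ j → j ≤ q → x.r j j ≤ x.α j

/-- The offer constraints of `LP_JMS`. -/
def Offers (q : ℕ) (x : JMSVars) : Prop :=
  ∀ i, 1 ≤ i → i ≤ q →
    ∑ j ∈ Finset.Ico 1 i, max (x.r j i - x.d j) 0
      + ∑ j ∈ Finset.Icc i q, max (x.α i - x.d j) 0 ≤ x.lam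

/-- The offer constraints of `LP⁺_JMS`. -/
def OffersPlus (q : ℕ) (x : JMSVars) : Prop :=
  ∀ i, 1 ≤ i → i ≤ q →
    ∑ j ∈ Finset.Icc 1 i, max (x.r j i - x.d j) 0
      + ∑ j ∈ Finset.Ioc i q, max (x.α i - x.d j) 0 ≤ x.lam

/-- The solution for an empty set of clients. -/
def ofLam (lam : ℝ) : JMSVars := ⟨fun _ => 0, fun _ => 0, fun _ _ => 0, lam⟩

instance : Add JMSVars :=
  ⟨fun x y => ⟨fun i => x.α i + y.α i, fun i => x.d i + y.d i, fun j i => x.r j i + y.r j i,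
    x.lam + y.lam⟩⟩

instance : SMul ℝ JMSVars :=
  ⟨fun c x => ⟨fun i => c * x.α i, fun i => c * x.d i, fun j i => c * x.r j i, c * x.lam⟩⟩

theorem cone_ofLam (q : ℕ) {lam : ℝ} (hlam : 0 ≤ lam) : (ofLam lam).Cone q := by
  refine ⟨?_, ?_, ?_, hlam, ?_, ?_, ?_, ?_⟩ <;> intros <;> simp [ofLam]

theorem offersPlus_ofLam (q : ℕ) {lam : ℝ} (hlam : 0 ≤ lam) : (ofLam lam).OffersPlus q := by
  intro i _ _
  simpa [ofLam] using hlam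

theorem Cone.add {q : ℕ} {x y : JMSVars} (hx : Cone q x) (hy : Cone q y) : Cone q (x + y) where
  α_nonneg i h1 h2 := add_nonneg (hx.α_nonneg i h1 h2) (hy.α_nonneg i h1 h2)
  d_nonneg i h1 h2 := add_nonneg (hx.d_nonneg i h1 h2) (hy.d_nonneg i h1 h2)
  r_nonneg j i h1 h2 h3 := add_nonneg (hx.r_nonneg j i h1 h2 h3) (hy.r_nonneg j i h1 h2 h3)
  lam_nonneg := add_nonneg hx.lam_nonneg hy.lam_nonneg
  α_mono i h1 h2 := add_le_add (hx.α_mono i h1 h2) (hy.α_mono i h1 h2)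
  r_anti j i h1 h2 h3 := add_le_add (hx.r_anti j i h1 h2 h3) (hy.r_anti j i h1 h2 h3)
  triangle j i h1 h2 h3 := by
    have h4 := hx.triangle j i h1 h2 h3
    have h5 := hy.triangle j i h1 h2 h3
    change x.α i + y.α i ≤ (x.r j i + y.r j i) + (x.d i + y.d i) + (x.d j + y.d j)
    linarith
  r_diag j h1 h2 := add_le_add (hx.r_diag j h1 h2) (hy.r_diag j h1 h2)

/-- The positive part is subadditive. This is what allows clusters to be merged. -/
theorem OffersPlus.add {q : ℕ} {x y : JMSVars} (hx : OffersPlus q x) (hy : OffersPlus q y) :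
    OffersPlus q (x + y) := by
  intro i h1 h2
  have hmax : ∀ s t u v : ℝ, max (s + t - (u + v)) 0 ≤ max (s - u) 0 + max (t - v) 0 := by
    intro s t u v
    refine max_le ?_ (add_nonneg (le_max_right _ _) (le_max_right _ _))
    have := le_max_left (s - u) 0
    have := le_max_left (t - v) 0
    linarith
  have h3 := hx i h1 h2
  have h4 := hy i h1 h2
  have h5 := Finset.sum_le_sum fun j (_ : j ∈ Finset.Icc 1 i) =>
    hmax (x.r j i) (y.r j i) (x.d j) (y.d j)
  have h6 := Finset.sum_le_sum fun j (_ : j ∈ Finset.Ioc i q) =>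
    hmax (x.α i) (y.α i) (x.d j) (y.d j)
  rw [Finset.sum_add_distrib] at h5 h6
  change ∑ j ∈ Finset.Icc 1 i, max (x.r j i + y.r j i - (x.d j + y.d j)) 0
    + ∑ j ∈ Finset.Ioc i q, max (x.α i + y.α i - (x.d j + y.d j)) 0 ≤ x.lam + y.lam
  linarith

theorem Cone.smul {q : ℕ} {x : JMSVars} (hx : Cone q x) {c : ℝ} (hc : 0 ≤ c) :
    Cone q (c • x) where
  α_nonneg i h1 h2 := mul_nonneg hc (hx.α_nonneg i h1 h2)
  d_nonneg i h1 h2 := mul_nonneg hc (hx.d_nonneg i h1 h2)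
  r_nonneg j i h1 h2 h3 := mul_nonneg hc (hx.r_nonneg j i h1 h2 h3)
  lam_nonneg := mul_nonneg hc hx.lam_nonneg
  α_mono i h1 h2 := mul_le_mul_of_nonneg_left (hx.α_mono i h1 h2) hc
  r_anti j i h1 h2 h3 := mul_le_mul_of_nonneg_left (hx.r_anti j i h1 h2 h3) hc
  triangle j i h1 h2 h3 := by
    have := mul_le_mul_of_nonneg_left (hx.triangle j i h1 h2 h3) hc
    change c * x.α i ≤ c * x.r j i + c * x.d i + c * x.d j
    linarith
  r_diag j h1 h2 := mul_le_mul_of_nonneg_left (hx.r_diag j h1 h2) hc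

theorem mul_max_sub {c : ℝ} (hc : 0 ≤ c) (s t : ℝ) :
    max (c * s - c * t) 0 = c * max (s - t) 0 := by
  rw [← mul_sub, mul_max_of_nonneg _ _ hc, mul_zero]

theorem Offers.smul {q : ℕ} {x : JMSVars} (hx : Offers q x) {c : ℝ} (hc : 0 ≤ c) :
    Offers q (c • x) := by
  intro i h1 h2
  change ∑ j ∈ Finset.Ico 1 i, max (c * x.r j i - c * x.d j) 0
    + ∑ j ∈ Finset.Icc i q, max (c * x.α i - c * x.d j) 0 ≤ c * x.lam
  simp only [mul_max_sub hc, ← Finset.mul_sum, ← mul_add]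
  exact mul_le_mul_of_nonneg_left (hx i h1 h2) hc

theorem OffersPlus.smul {q : ℕ} {x : JMSVars} (hx : OffersPlus q x) {c : ℝ} (hc : 0 ≤ c) :
    OffersPlus q (c • x) := by
  intro i h1 h2
  change ∑ j ∈ Finset.Icc 1 i, max (c * x.r j i - c * x.d j) 0
    + ∑ j ∈ Finset.Ioc i q, max (c * x.α i - c * x.d j) 0 ≤ c * x.lam
  simp only [mul_max_sub hc, ← Finset.mul_sum, ← mul_add]
  exact mul_le_mul_of_nonneg_left (hx i h1 h2) hc

theorem Cone.common {q : ℕ} {x : JMSVars} (hx : Cone q x) {D T : ℝ} (hD : 0 < D)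
    (hd : ∑ i ∈ Finset.Icc 1 q, x.d i = D) (hT : x.lam ≤ T * D) : (D⁻¹ • x).Common q T := by
  have h := hx.smul (inv_nonneg.2 hD.le)
  refine ⟨h.α_nonneg, h.d_nonneg, h.r_nonneg, h.lam_nonneg, ?_, h.α_mono, h.r_anti, h.triangle,
    h.r_diag, ?_⟩
  · change ∑ i ∈ Finset.Icc 1 q, D⁻¹ * x.d i = 1
    rw [← Finset.mul_sum, hd, inv_mul_cancel₀ hD.ne']
  · change D⁻¹ * x.lam ≤ T
    rwa [inv_mul_le_iff₀ hD, mul_comm]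

theorem value_smul (q : ℕ) (x : JMSVars) (c : ℝ) :
    (c • x).value q = c * (∑ i ∈ Finset.Icc 1 q, x.α i - x.lam) := by
  change ∑ i ∈ Finset.Icc 1 q, c * x.α i - c * x.lam = _
  rw [← Finset.mul_sum, mul_sub]

/-- The solution obtained from a sequence of `q * c` clients by merging the clients of each of the
`q` blocks of `c` consecutive ones; `p` is as in `IsTailArgmax`. -/
def grouped (c : ℕ) (a d : ℕ → ℝ) (p : ℕ → ℕ) (Λ : ℝ) : JMSVars where
  α h := ∑ b ∈ Finset.range c, a ((h - 1) * c + b)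
  d h := ∑ b ∈ Finset.range c, d ((h - 1) * c + b)
  r g h := (∑ l ∈ Finset.range c, ∑ b ∈ Finset.range c,
    max (a (p ((h - 1) * c + l)) - d (p ((h - 1) * c + l)) - d ((g - 1) * c + b)) 0) / c
  lam := Λ

theorem _root_.block_lt {q c h b : ℕ} (h1 : 1 ≤ h) (hq : h ≤ q) (hb : b < c) :
    (h - 1) * c + b < q * c := by
  have : h * c ≤ q * c := Nat.mul_le_mul_right c hq
  obtain ⟨h, rfl⟩ := Nat.exists_eq_add_of_le' h1
  rw [Nat.add_mul] at this
  simp only [Nat.add_sub_cancel]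
  omega

theorem sum_grouped_α (q c : ℕ) (a d : ℕ → ℝ) (p : ℕ → ℕ) (Λ : ℝ) :
    ∑ h ∈ Finset.Icc 1 q, (grouped c a d p Λ).α h = ∑ k ∈ Finset.range (q * c), a k := by
  rw [Finset.sum_range_mul_blocks, ← Finset.sum_Icc_pred]
  rfl

theorem sum_grouped_d (q c : ℕ) (a d : ℕ → ℝ) (p : ℕ → ℕ) (Λ : ℝ) :
    ∑ h ∈ Finset.Icc 1 q, (grouped c a d p Λ).d h = ∑ k ∈ Finset.range (q * c), d k := by
  rw [Finset.sum_range_mul_blocks, ← Finset.sum_Icc_pred]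
  rfl

variable {q c : ℕ} {a d : ℕ → ℝ} {ρ : ℕ → ℕ → ℝ} {Λ : ℝ} {p : ℕ → ℕ}

/-- Antitonicity of r holds because the tails over which p maximizes shrink. The triangle constraint
is the sum of a l - d l ≤ a (p l) - d (p l) over all pairs from two blocks, divided by c. -/
theorem cone_grouped (hc : 0 < c) (hs : ClientSequence (q * c) a d ρ Λ)
    (hp : IsTailArgmax (q * c) (fun k => a k - d k) p) : (grouped c a d p Λ).Cone q where
  α_nonneg i _ _ := by
    dsimp only [grouped]
    exact Finset.sum_nonneg fun b _ => hs.a_nonneg _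
  d_nonneg i _ _ := by
    dsimp only [grouped]
    exact Finset.sum_nonneg fun b _ => hs.d_nonneg _
  r_nonneg j i _ _ _ := div_nonneg (Finset.sum_nonneg fun _ _ => Finset.sum_nonneg fun _ _ =>
    le_max_right _ _) (Nat.cast_nonneg c)
  lam_nonneg := (Finset.sum_nonneg fun _ _ => le_max_right _ _).trans (hs.offers_le 0)
  α_mono i h1 _ := by
    dsimp only [grouped]
    exact Finset.sum_le_sum fun b _ => hs.a_mono <| by gcongr; exact i.le_succ
  r_anti j i h1 h2 h3 := by
    refine div_le_div_of_nonneg_right (Finset.sum_le_sum fun l hl => Finset.sum_le_sum fun b _ => ?_)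
      (Nat.cast_nonneg c)
    have := hp.antitone (l := (i - 1) * c + l) (l' := (i + 1 - 1) * c + l) (by gcongr; omega)
      (block_lt (by omega) (by omega) (Finset.mem_range.1 hl))
    gcongr max (?_ - _) 0
  triangle j i h1 h2 h3 := by
    have hc' : (0 : ℝ) < c := by exact_mod_cast hc
    have h : ∀ l ∈ Finset.range c, ∀ b ∈ Finset.range c, a ((i - 1) * c + l) ≤
        max (a (p ((i - 1) * c + l)) - d (p ((i - 1) * c + l)) - d ((j - 1) * c + b)) 0
          + d ((i - 1) * c + l) + d ((j - 1) * c + b) := by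
      intro l hl b _
      have hlt := block_lt (q := q) (c := c) (h := i) (by omega) h3 (Finset.mem_range.1 hl)
      have := (hp _ hlt).2.2 _ le_rfl hlt
      have := le_max_left
        (a (p ((i - 1) * c + l)) - d (p ((i - 1) * c + l)) - d ((j - 1) * c + b)) 0
      linarith
    have := Finset.sum_le_sum fun l hl => Finset.sum_le_sum (h l hl)
    simp only [Finset.sum_add_distrib, Finset.sum_const, Finset.card_range, nsmul_eq_mul,
      ← Finset.mul_sum] at this
    rw [← mul_le_mul_iff_right₀ hc', mul_add, mul_add]
    simpa only [grouped, mul_div_cancel₀ _ hc'.ne'] using this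
  r_diag j _ _ := by
    have hc' : (0 : ℝ) < c := by exact_mod_cast hc
    change _ / _ ≤ _
    rw [div_le_iff₀' hc']
    have : ∀ l ∈ Finset.range c, ∑ b ∈ Finset.range c,
        max (a (p ((j - 1) * c + l)) - d (p ((j - 1) * c + l)) - d ((j - 1) * c + b)) 0
          ≤ ∑ b ∈ Finset.range c, a ((j - 1) * c + b) := fun l _ =>
      Finset.sum_le_sum fun b _ => max_le (hs.tail_sub_le _ _) (hs.a_nonneg _)
    simpa [grouped] using Finset.sum_le_sum this

theorem offers_grouped (hs : ClientSequence q a d ρ Λ)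
    (hp : IsTailArgmax q (fun k => a k - d k) p) : (grouped 1 a d p Λ).Offers q := by
  intro i h1 h2
  -- LP indices start at 1, client indices at 0.
  refine le_trans (le_of_eq ?_) (hs.sum_jms_le hp (l := i - 1) (by omega))
  rw [← Finset.sum_Icc_pred]
  have hico : Finset.Icc 1 q = Finset.Ico 1 (q + 1) := by ext; simp
  have hico' : Finset.Icc i q = Finset.Ico i (q + 1) := by ext; simp
  rw [hico, hico', ← Finset.sum_Ico_consecutive _ h1 (by omega : i ≤ q + 1)]
  congr 1 <;> refine Finset.sum_congr rfl fun j hj => ?_ <;> rw [Finset.mem_Ico] at hj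
  · rw [if_pos (by omega)]
    simp [grouped]
  · rw [if_neg (by omega)]
    simp [grouped]

/-- Jensen's inequality for the positive part, averaging over l. -/
theorem max_average_sub_le (hc : 0 < c) (u w : ℕ → ℕ → ℝ) (e : ℕ → ℝ)
    (h : ∀ l < c, ∀ b < c, max (u l b - e b) 0 ≤ w l b) :
    max ((∑ l ∈ Finset.range c, ∑ b ∈ Finset.range c, u l b) / c - ∑ b ∈ Finset.range c, e b) 0
      ≤ (∑ l ∈ Finset.range c, ∑ b ∈ Finset.range c, w l b) / c := by
  have hc' : (0 : ℝ) < c := by exact_mod_cast hc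
  refine max_le ?_ (div_nonneg (Finset.sum_nonneg fun l hl => Finset.sum_nonneg fun b hb =>
    (le_max_right _ _).trans (h l (Finset.mem_range.1 hl) b (Finset.mem_range.1 hb))) hc'.le)
  have := Finset.sum_le_sum fun l hl => Finset.sum_le_sum fun b hb =>
    (le_max_left _ _).trans (h l (Finset.mem_range.1 hl) b (Finset.mem_range.1 hb))
  simp only [Finset.sum_sub_distrib, Finset.sum_const, Finset.card_range, nsmul_eq_mul] at this
  rwa [le_div_iff₀ hc', sub_mul, div_mul_cancel₀ _ hc'.ne', mul_comm _ (c : ℝ)]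

theorem offersPlus_grouped (hc : 0 < c) (hs : ClientSequence (q * c) a d ρ Λ)
    (hp : IsTailArgmax (q * c) (fun k => a k - d k) p) : (grouped c a d p Λ).OffersPlus q := by
  intro i h1 h2
  have hc' : (0 : ℝ) < c := by exact_mod_cast hc
  -- The cutoff is L = i * c, the end of block i, for every l in that block; averaging over these l
  -- gives constraint i.
  set w : ℕ → ℕ → ℝ := fun l k => max ((if k < i * c then
    max (a (p ((i - 1) * c + l)) - d (p ((i - 1) * c + l)) - d k) 0
    else a ((i - 1) * c + l)) - d k) 0 with hw
  have hsum : ∑ j ∈ Finset.Icc 1 q,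
      (∑ l ∈ Finset.range c, ∑ b ∈ Finset.range c, w l ((j - 1) * c + b)) / c ≤ Λ := by
    rw [← Finset.sum_div, div_le_iff₀' hc', Finset.sum_comm]
    have : ∀ l ∈ Finset.range c, ∑ j ∈ Finset.Icc 1 q, ∑ b ∈ Finset.range c,
        w l ((j - 1) * c + b) ≤ Λ := by
      intro l hl
      rw [Finset.sum_Icc_pred q fun j => ∑ b ∈ Finset.range c, w l (j * c + b),
        ← Finset.sum_range_mul_blocks]
      exact hs.sum_jmsPlus_le hp (block_lt h1 le_rfl (Finset.mem_range.1 hl))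
        (Nat.mul_le_mul_right c h2)
    simpa using Finset.sum_le_sum this
  refine le_trans ?_ hsum
  have hioc : ∀ n, Finset.Icc 1 n = Finset.Ioc 0 n := fun n => by ext; simp; omega
  rw [hioc, hioc, ← Finset.sum_Ioc_consecutive _ i.zero_le h2]
  refine add_le_add (Finset.sum_le_sum fun j hj => ?_) (Finset.sum_le_sum fun j hj => ?_) <;>
    rw [Finset.mem_Ioc] at hj
  · refine max_average_sub_le hc (fun l b => max (a (p ((i - 1) * c + l)) -
      d (p ((i - 1) * c + l)) - d ((j - 1) * c + b)) 0) _ (fun b => d ((j - 1) * c + b)) ?_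
    intro l _ b hb
    have : (j - 1) * c + b < i * c := block_lt (by omega) hj.2 hb
    simp only [hw, if_pos this, le_refl]
  · have hα : (grouped c a d p Λ).α i =
        (∑ l ∈ Finset.range c, ∑ _b ∈ Finset.range c, a ((i - 1) * c + l)) / c := by
      simp only [Finset.sum_const, Finset.card_range, nsmul_eq_mul, ← Finset.mul_sum]
      rw [mul_div_cancel_left₀ _ hc'.ne']
      rfl
    rw [hα]
    refine max_average_sub_le hc (fun l _ => a ((i - 1) * c + l)) _
      (fun b => d ((j - 1) * c + b)) ?_
    intro l _ b _
    have : ¬ (j - 1) * c + b < i * c := by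
      have : i * c ≤ (j - 1) * c := Nat.mul_le_mul_right c (by omega)
      omega
    simp only [hw, if_neg this, le_refl]

end JMSVars

/-! ### From clusters to LP solutions -/

theorem Finset.exists_monotone_enum {C : Type*} (K : Finset C) (hK : K.Nonempty) (τ : C → ℕ) :
    ∃ e : ℕ → C, Monotone (fun k => τ (e k)) ∧
      ∀ G : C → ℝ, ∑ k ∈ Finset.range K.card, G (e k) = ∑ j ∈ K, G j := by
  obtain ⟨n, hn⟩ : ∃ n, K.card = n + 1 := Nat.exists_eq_succ_of_ne_zero hK.card_pos.ne'
  let e₀ : Fin (n + 1) ≃ K := (K.equivFinOfCardEq hn).symm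
  let π := Tuple.sort fun i => τ (e₀ i)
  have hπ : Monotone fun i => τ (e₀ (π i)) := Tuple.monotone_sort fun i => τ (e₀ i)
  -- Past the end the last client is repeated, which keeps the enumeration monotone on all of ℕ.
  refine ⟨fun k => e₀ (π ⟨min k n, by omega⟩), fun k l hkl => hπ ?_, fun G => ?_⟩
  · exact Fin.mk_le_mk.2 (min_le_min_right n hkl)
  · rw [hn, Finset.sum_range, ← Finset.sum_coe_sort K, ← (π.trans e₀).sum_comp]
    refine Finset.sum_congr rfl fun i _ => ?_
    simp [Nat.le_of_lt_succ i.2]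

namespace UFLProblem

variable {F C : Type*} [Fintype C] {P : UFLProblem F C} {S : Finset F} {τ : C → ℕ} {α : C → ℝ}
  {ρ : C → C → ℝ}

theorem JMSDual.clientSequence (h : P.JMSDual S τ α ρ) (K : Finset C) (f : F) {e : ℕ → C}
    (he : Monotone fun k => τ (e k))
    (hsum : ∀ G : C → ℝ, ∑ k ∈ Finset.range K.card, G (e k) = ∑ j ∈ K, G j) :
    ClientSequence K.card (fun k => α (e k)) (fun k => P.dist (e k) f)
      (fun l k => ρ (e l) (e k)) (P.openCost f) where
  a_nonneg _ := h.α_nonneg _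
  d_nonneg _ := P.dist_nonneg _ _
  a_mono _ _ hkl := h.α_mono _ _ (he hkl)
  radius_eq _ _ hlk := h.radius_eq _ _ (he hlk)
  triangle _ _ _ h1 h2 := h.triangle _ _ _ _ (he h1) (he h2)
  offers_le l := by
    rw [hsum fun j => max (ρ (e l) j - P.dist j f) 0]
    exact (Finset.sum_le_univ_sum_of_nonneg fun j => le_max_right _ _).trans (h.offers_le _ f)

theorem JMSDual.exists_offers (h : P.JMSDual S τ α ρ) {K : Finset C} (hK : K.Nonempty) (f : F) :
    ∃ x : JMSVars, x.Cone K.card ∧ x.Offers K.card ∧ x.lam = P.openCost f ∧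
      ∑ i ∈ Finset.Icc 1 K.card, x.α i = ∑ j ∈ K, α j ∧
      ∑ i ∈ Finset.Icc 1 K.card, x.d i = ∑ j ∈ K, P.dist j f := by
  obtain ⟨e, he, hsum⟩ := K.exists_monotone_enum hK τ
  have hs := h.clientSequence K f he hsum
  obtain ⟨p, hp⟩ := exists_isTailArgmax K.card fun k => α (e k) - P.dist (e k) f
  refine ⟨_, JMSVars.cone_grouped one_pos (by rwa [mul_one]) (by rwa [mul_one]),
    JMSVars.offers_grouped hs hp, rfl, ?_, ?_⟩
  · rw [JMSVars.sum_grouped_α, mul_one, hsum α]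
  · rw [JMSVars.sum_grouped_d, mul_one, hsum fun j => P.dist j f]

/-- Each client becomes q copies of weight 1/q, grouped into q blocks of |K|, so the dimension q
does not depend on the cluster. -/
theorem JMSDual.exists_offersPlus (h : P.JMSDual S τ α ρ) (K : Finset C) (f : F) {q : ℕ}
    (hq : 0 < q) :
    ∃ x : JMSVars, x.Cone q ∧ x.OffersPlus q ∧ x.lam = P.openCost f ∧
      ∑ i ∈ Finset.Icc 1 q, x.α i = ∑ j ∈ K, α j ∧
      ∑ i ∈ Finset.Icc 1 q, x.d i = ∑ j ∈ K, P.dist j f := by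
  rcases K.eq_empty_or_nonempty with rfl | hK
  · have := P.openCost_nonneg f
    exact ⟨_, JMSVars.cone_ofLam q this, JMSVars.offersPlus_ofLam q this, rfl, by
      simp [JMSVars.ofLam], by simp [JMSVars.ofLam]⟩
  obtain ⟨e, he, hsum⟩ := K.exists_monotone_enum hK τ
  have hs := (h.clientSequence K f he hsum).comp hq
  obtain ⟨p, hp⟩ := exists_isTailArgmax (K.card * q)
    fun k => α (e (k / q)) - P.dist (e (k / q)) f
  have hq' : (0 : ℝ) < q := by exact_mod_cast hq
  have hinv : 0 ≤ (q : ℝ)⁻¹ := (inv_pos.2 hq').le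
  have hcomm := mul_comm K.card q
  rw [hcomm] at hs hp
  refine ⟨_, (JMSVars.cone_grouped hK.card_pos hs hp).smul hinv,
    (JMSVars.offersPlus_grouped hK.card_pos hs hp).smul hinv, ?_, ?_, ?_⟩
  · exact inv_mul_cancel_left₀ hq'.ne' _
  · refine (Finset.mul_sum _ _ _).symm.trans ?_
    rw [JMSVars.sum_grouped_α, ← hcomm, Finset.sum_range_div K.card q hq fun k => α (e k), hsum α,
      inv_mul_cancel_left₀ hq'.ne']
  · refine (Finset.mul_sum _ _ _).symm.trans ?_
    rw [JMSVars.sum_grouped_d, ← hcomm,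
      Finset.sum_range_div K.card q hq fun k => P.dist (e k) f, hsum fun j => P.dist j f,
      inv_mul_cancel_left₀ hq'.ne']

theorem JMSDual.exists_offersPlus_sum (h : P.JMSDual S τ α ρ) (K : F → Finset C) {q : ℕ}
    (hq : 0 < q) (A : Finset F) :
    ∃ x : JMSVars, x.Cone q ∧ x.OffersPlus q ∧ x.lam = P.openSum A ∧
      ∑ i ∈ Finset.Icc 1 q, x.α i = ∑ f ∈ A, ∑ j ∈ K f, α j ∧
      ∑ i ∈ Finset.Icc 1 q, x.d i = ∑ f ∈ A, ∑ j ∈ K f, P.dist j f := by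
  classical
  induction A using Finset.induction_on with
  | empty =>
    exact ⟨_, JMSVars.cone_ofLam q le_rfl, JMSVars.offersPlus_ofLam q le_rfl, by
      simp [JMSVars.ofLam, openSum], by simp [JMSVars.ofLam], by simp [JMSVars.ofLam]⟩
  | insert f A hf ih =>
    obtain ⟨x, hx, hx', hxl, hxα, hxd⟩ := ih
    obtain ⟨y, hy, hy', hyl, hyα, hyd⟩ := h.exists_offersPlus (K f) f hq
    refine ⟨y + x, hy.add hx, hy'.add hx', ?_, ?_, ?_⟩
    · rw [openSum, Finset.sum_insert hf, ← hyl, ← openSum, ← hxl]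
      rfl
    · rw [Finset.sum_insert hf, ← hyα, ← hxα]
      exact Finset.sum_add_distrib
    · rw [Finset.sum_insert hf, ← hyd, ← hxd]
      exact Finset.sum_add_distrib

theorem _root_.EReal.coe_le_mul_of_div_le {v D : ℝ} (hD : 0 < D) {o : EReal}
    (h : ((D⁻¹ * v : ℝ) : EReal) ≤ o) : (v : EReal) ≤ o * (D : EReal) := by
  have h1 : (v : EReal) = ((D⁻¹ * v : ℝ) : EReal) * (D : EReal) := by
    rw [← EReal.coe_mul, mul_comm, mul_inv_cancel_left₀ hD.ne']
  rw [h1]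
  exact mul_le_mul_of_nonneg_right h (EReal.coe_nonneg.2 hD.le)

variable [DecidableEq F]

theorem servedCost_nonneg (P : UFLProblem F C) (σ : C → F) (f : F) : 0 ≤ P.servedCost σ f :=
  Finset.sum_nonneg fun j _ => P.dist_nonneg j f

theorem JMSDual.sum_cluster_le_optJMS (h : P.JMSDual S τ α ρ) (σ : C → F) (f : F) :
    ((∑ j with σ j = f, α j - P.openCost f : ℝ) : EReal) ≤
      optJMS (P.openCost f / P.servedCost σ f) * (P.servedCost σ f : EReal) := by
  rcases (P.servedCost_nonneg σ f).eq_or_lt with h0 | hpos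
  -- With zero connection cost the right side is 0 even if the LP value is infinite, so the sum of α
  -- must be at most open(f).
  · have := h.sum_le_two {j | σ j = f} f
    change _ ≤ _ + 2 * P.servedCost σ f at this
    rw [← h0, EReal.coe_zero, mul_zero]
    exact_mod_cast (by linarith)
  · have hK : (Finset.univ.filter fun j => σ j = f).Nonempty := by
      by_contra hne
      rw [Finset.not_nonempty_iff_eq_empty] at hne
      rw [servedCost, hne] at hpos
      simp at hpos
    obtain ⟨x, hx, hx', hxl, hxα, hxd⟩ := h.exists_offers hK f
    refine EReal.coe_le_mul_of_div_le hpos ?_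
    refine le_trans (le_trans (le_of_eq ?_) (le_iSup₂ (f := fun (y : JMSVars) (_ : y.Feasible _ _) =>
      ((y.value _ : ℝ) : EReal)) ((P.servedCost σ f)⁻¹ • x)
      ⟨hx.common hpos hxd ?_, hx'.smul (inv_pos.2 hpos).le⟩))
      (le_iSup₂ (f := fun q (_ : 0 < q) => optJMSq q _) _ hK.card_pos)
    · rw [JMSVars.value_smul, hxα, hxl]
    · rw [hxl, div_mul_cancel₀ _ hpos.ne']

/-- Single facilities may exceed the ratio T; only the totals over A obey it. The clusters are
therefore added first and normalized afterwards. -/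
theorem JMSDual.sum_clusters_le_optJMSPlus (h : P.JMSDual S τ α ρ) (σ : C → F) {A : Finset F}
    {T : ℝ} (hA : P.openSum A ≤ T * P.servedCostSum σ A) {q : ℕ} (hq : 0 < q) :
    ((∑ f ∈ A, ∑ j with σ j = f, α j - P.openSum A : ℝ) : EReal) ≤
      optJMSPlus q T * (P.servedCostSum σ A : EReal) := by
  have hnn : 0 ≤ P.servedCostSum σ A := Finset.sum_nonneg fun f _ => P.servedCost_nonneg σ f
  rcases hnn.eq_or_lt with h0 | hpos
  · have := Finset.sum_le_sum fun f (_ : f ∈ A) => h.sum_le_two {j | σ j = f} f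
    rw [Finset.sum_add_distrib, ← Finset.mul_sum] at this
    change _ ≤ P.openSum A + 2 * P.servedCostSum σ A at this
    rw [← h0, EReal.coe_zero, mul_zero]
    exact_mod_cast (by linarith)
  · obtain ⟨x, hx, hx', hxl, hxα, hxd⟩ :=
      h.exists_offersPlus_sum (fun f => {j | σ j = f}) hq A
    refine EReal.coe_le_mul_of_div_le hpos ?_
    refine le_trans (le_of_eq ?_) (le_iSup₂ (f := fun (y : JMSVars) (_ : y.FeasiblePlus q T) =>
      ((y.value q : ℝ) : EReal)) ((P.servedCostSum σ A)⁻¹ • x)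
      ⟨hx.common hpos hxd (hxl ▸ hA), hx'.smul (inv_pos.2 hpos).le⟩)
    rw [JMSVars.value_smul, hxα, hxl]

end UFLProblem

end

/-- Both bounds on the cost of a JMS solution `S` against a solution `OPT` whose clients are served
according to `σ`. In `EReal` one has `∞ * 0 = 0`; a facility `f` with `d(f) = 0` contributes `0`
to the sum in the first bound. -/
theorem mainTheorem5 {F C : Type*} [Fintype F] [Fintype C] [DecidableEq F] [DecidableEq C]
    (P : UFLProblem F C) (OPT : Finset F) (σ : C → F) (hσ : P.IsServedBy OPT σ)
    (S : Finset F) (hS : P.IsJMSOutput S) :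
    ((P.openSum S : EReal) + P.connCost S ≤
      (P.openSum OPT : EReal) +
        ∑ f ∈ OPT, optJMS (P.openCost f / P.servedCost σ f) * (P.servedCost σ f : EReal)) ∧
    ∀ T : ℝ, 0 < T → ∀ OPT' : Finset F, OPT' ⊆ OPT →
      P.openSum OPT' ≤ T * P.servedCostSum σ OPT' →
      ∀ q : ℕ, 0 < q →
        (P.openSum S : EReal) + P.connCost S ≤
          (P.openSum OPT : EReal) + 2 * (P.servedCostSum σ (OPT \ OPT') : EReal)
            + optJMSPlus q T * (P.servedCostSum σ OPT' : EReal) := by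
  obtain ⟨τ, α, ρ, h⟩ := hS.exists_dual
  have hα : ∑ j, α j = ∑ f ∈ OPT, ∑ j with σ j = f, α j :=
    (Finset.sum_fiberwise_of_maps_to (fun j _ => (hσ j).1) α).symm
  refine ⟨h.cost_le.trans ?_, fun T _ OPT' hsub hT q hq => h.cost_le.trans ?_⟩
  · have hle := Finset.sum_le_sum fun f (_ : f ∈ OPT) => h.sum_cluster_le_optJMS σ f
    rw [← EReal.coe_finset_sum, Finset.sum_sub_distrib, ← hα] at hle
    refine le_trans (le_of_eq ?_) (add_le_add le_rfl hle)
    rw [← EReal.coe_add]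
    congr 1
    exact (add_sub_cancel _ _).symm
  · have h1 := h.sum_clusters_le_optJMSPlus σ hT hq
    -- Outside OPT' each cluster is charged by the factor 2 bound.
    have h2 := Finset.sum_le_sum fun f (_ : f ∈ OPT \ OPT') => h.sum_le_two {j | σ j = f} f
    rw [Finset.sum_add_distrib, ← Finset.mul_sum] at h2
    change _ ≤ P.openSum (OPT \ OPT') + 2 * P.servedCostSum σ (OPT \ OPT') at h2
    have h3 : P.openSum (OPT \ OPT') + P.openSum OPT' = P.openSum OPT := Finset.sum_sdiff hsub
    rw [← Finset.sum_sdiff hsub] at hα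
    refine le_trans ?_ (add_le_add le_rfl h1)
    have h4 : (2 : EReal) = ((2 : ℝ) : EReal) := rfl
    rw [h4, ← EReal.coe_mul, ← EReal.coe_add, ← EReal.coe_add, EReal.coe_le_coe_iff, hα]
    linarith
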